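/- **Setting.** Let $v>0$, $\sigma>0$, $\eta\ge 0$, and let $B=(B_t)_{t\ge0}$ be a standard Brownian motion relative to the filtration of a filtered probability space $(\Omega,\mathcal F,(\mathcal F_t)_{t\ge0},\mathbb P)$. For $r>0$ define $\mu_1(\theta,a)$ and $\mu_2(r,\theta,a)$, $a\in\{+1,-1\}$, as the $2\pi$-periodic functions of $\theta\in\mathbb R$ given on $[-\frac{\pi}{4},\frac{7\pi}{4})$ by $$(\mu_1,\mu_2)(r,\theta,+1)=\begin{cases}(-v\sin\theta,\,-\frac{v\cos\theta}{r}), & \theta\in[-\frac\pi4,\frac\pi2),\\ (-v,\,0), & \theta\in[\frac\pi2,\pi),\\ (v\cos\theta,\,-\frac{v\sin\theta}{r}), & \theta\in[\pi,\frac{7\pi}4),\end{cases}$$ $$(\mu_1,\mu_2)(r,\theta,-1)=\begin{cases}(-v,\,0), & \theta\in[-\frac\pi4,0)\cup[\frac{3\pi}2,\frac{7\pi}4),\\ (-v\cos\theta,\,\frac{v\sin\theta}{r}), & \theta\in[0,\frac{3\pi}4),\\ (v\sin\theta,\,\frac{v\cos\theta}{r}), & \theta\in[\frac{3\pi}4,\frac{3\pi}2).\end{cases}$$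 Fix $(r,\theta)\in[\eta,\infty)\times\mathbb R$. For a $\{+1,-1\}$-valued process $A$, the position process $(R^A,\Theta^A)$ is the strong solution (continuous, adapted to $(\mathcal F_t)$, on the given space and with the given $B$), up to the time $\tau^A=\inf\{t\ge0: R^A_t\le\eta\}$ (with $\inf\emptyset=\infty$), of $$dR^A_t=1_{\{R^A_t>\eta\}}\,\mu_1(\Theta^A_t,A_t)\,dt,\qquad d\Theta^A_t=1_{\{R^A_t>\eta\}}\left[\mu_2(R^A_t,\Theta^A_t,A_t)\,dt+\sigma\,dB_t\right],\qquad (R^A_0,\Theta^A_0)=(r,\theta);$$ that is, the integrated equations hold at every $t<\tau^A$. The strategy $A$ is *admissible* if it is jointly measurable and $(\mathcal F_t)$-adapted, this system has a strong solution, and $\mathbb E(\tau^A)<\infty$. Let $\mathcal A$ be the set of admissible strategies, $J(r,\theta,A)=\mathbb E(\tau^A)$ and $V^\eta(r,\theta)=\inf_{A\in\mathcal A}J(r,\theta,A)$ (with $\inf\emptyset=+\infty$). A strategy $A^\star\in\mathcal A$ is *optimal* if $J(r,\theta,A^\star)=V^\eta(r,\theta)$. **Theorem.** Let $\tilde V:[\eta,\infty)\times\mathbb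 R\to\mathbb R_+$ be a continuous function such that (a) $\tilde V(\eta,\vartheta)=0$ for all $\vartheta\in\mathbb R$; (b) $\tilde V(\rho,\vartheta)\to\tilde V(\eta,\vartheta)$ as $\rho\downarrow\eta$, uniformly in $\vartheta\in\mathbb R$; (c) there are $C,D\in\mathbb R_+$ with $\tilde V(\rho,\vartheta)\le C\rho+D$ for all $(\rho,\vartheta)\in[\eta,\infty)\times\mathbb R$. For $A\in\mathcal A$ put $$N^A_t=(t\wedge\tau^A)+\tilde V\left(R^A_{t\wedge\tau^A},\Theta^A_{t\wedge\tau^A}\right),\qquad t\ge0.$$ (1) If, for every $A\in\mathcal A$, the process $(N^A_t)_{t\ge0}$ is a submartingale with respect to $(\mathcal F_t)$, then $\tilde V(r,\theta)\le V^\eta(r,\theta)$. (2) If, in addition, there is $A^\star\in\mathcal A$ for which $(N^{A^\star}_t)_{t\ge0}$ is a martingale, then $\tilde V(r,\theta)=V^\eta(r,\theta)$ and $A^\star$ is optimal. -/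

import Mathlib

open MeasureTheory ProbabilityTheory Filter Topology
open scoped NNReal ENNReal

noncomputable section

namespace Sailing

/-- The representative of the angle `θ` modulo `2π` in `[-π/4, 7π/4)`. -/
def angle (θ : ℝ) : ℝ := toIcoMod Real.two_pi_pos (-(Real.pi / 4)) θ

/-- Radial drift `μ₁(θ, a)` of a boat of speed `v` on tack `a` (`1`: starboard, `-1`: port),
`2π`-periodic in `θ`. -/
def radialDrift (v θ : ℝ) (a : ℤˣ) : ℝ :=
  if a = 1 then
    if angle θ < Real.pi / 2 then -v * Real.sin (angle θ)
    else if angle θ < Real.pi then -v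
    else v * Real.cos (angle θ)
  else
    if angle θ < 0 then -v
    else if angle θ < 3 * Real.pi / 4 then -v * Real.cos (angle θ)
    else if angle θ < 3 * Real.pi / 2 then v * Real.sin (angle θ)
    else -v

/-- Angular drift `μ₂(r, θ, a)`, `2π`-periodic in `θ`; it is only used for `r > 0`. -/
def angularDrift (v r θ : ℝ) (a : ℤˣ) : ℝ :=
  if a = 1 then
    if angle θ < Real.pi / 2 then -(v * Real.cos (angle θ) / r)
    else if angle θ < Real.pi then 0
    else -(v * Real.sin (angle θ) / r)
  else
    if angle θ < 0 then 0
    else if angle θ < 3 * Real.pi / 4 then v * Real.sin (angle θ) / r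
    else if angle θ < 3 * Real.pi / 2 then v * Real.cos (angle θ) / r
    else 0

variable {Ω : Type*} {mΩ : MeasurableSpace Ω}

/-- `B` is a standard real Brownian motion relative to the filtration `𝓕`. -/
structure IsFiltrationBrownian (𝓕 : Filtration ℝ≥0 mΩ) (P : Measure Ω) (B : ℝ≥0 → Ω → ℝ) :
    Prop where
  isBrownian : IsBrownianReal B P
  adapted : Adapted 𝓕 B
  indep_increment : ∀ s t : ℝ≥0, s ≤ t →
    Indep (MeasurableSpace.comap (fun ω => B t ω - B s ω) inferInstance) (𝓕 s) P

/-- The time `τ = inf {t ≥ 0 : R t ≤ η}` to reach the target (`∞` if it is never reached). -/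
def arrivalTime (η : ℝ) (R : ℝ≥0 → Ω → ℝ) (ω : Ω) : ℝ≥0∞ :=
  ⨅ (t : ℝ≥0) (_ : R t ω ≤ η), (t : ℝ≥0∞)

/-- `(R, Θ)` is a position process driven by the strategy `A` and started at `(r, θ)`: a strong
solution (on the given filtered space, with the given Brownian motion `B`), up to the arrival time
`τ`, of
`dR = 1_{R > η} μ₁(Θ, A) dt`, `dΘ = 1_{R > η} (μ₂(R, Θ, A) dt + σ dB)`, `(R, Θ)_0 = (r, θ)`.
Since `R > η` on `[0, τ)`, the indicators equal `1` there and the stochastic integral is `σ B`;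
by continuity of the paths the equation determines the value at `τ` as well. What the processes do
after `τ` is irrelevant. -/
structure IsPositionProcess (𝓕 : Filtration ℝ≥0 mΩ) (P : Measure Ω) (B : ℝ≥0 → Ω → ℝ)
    (σ v η r θ : ℝ) (A : ℝ≥0 → Ω → ℤˣ) (R Θ : ℝ≥0 → Ω → ℝ) : Prop where
  adapted_radius : Adapted 𝓕 R
  adapted_angle : Adapted 𝓕 Θ
  continuous_radius : ∀ ω, Continuous fun t => R t ω
  continuous_angle : ∀ ω, Continuous fun t => Θ t ω
  initial_radius : ∀ ω, R 0 ω = r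
  initial_angle : ∀ ω, Θ 0 ω = θ
  radius_eq : ∀ᵐ ω ∂P, ∀ t : ℝ≥0, (t : ℝ≥0∞) < arrivalTime η R ω →
    IntervalIntegrable (fun s : ℝ => radialDrift v (Θ s.toNNReal ω) (A s.toNNReal ω))
      volume 0 t ∧
    R t ω = r + ∫ s in (0 : ℝ)..t, radialDrift v (Θ s.toNNReal ω) (A s.toNNReal ω)
  angle_eq : ∀ᵐ ω ∂P, ∀ t : ℝ≥0, (t : ℝ≥0∞) < arrivalTime η R ω →
    IntervalIntegrable (fun s : ℝ => angularDrift v (R s.toNNReal ω) (Θ s.toNNReal ω)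
      (A s.toNNReal ω)) volume 0 t ∧
    Θ t ω = θ + (∫ s in (0 : ℝ)..t, angularDrift v (R s.toNNReal ω) (Θ s.toNNReal ω)
      (A s.toNNReal ω)) + σ * B t ω

/-- `A` is an admissible strategy for the initial position `(r, θ)`: a jointly measurable adapted
`{1, -1}`-valued process for which the system has a strong solution with `E[τ] < ∞`. -/
structure IsAdmissible (𝓕 : Filtration ℝ≥0 mΩ) (P : Measure Ω) (B : ℝ≥0 → Ω → ℝ)
    (σ v η r θ : ℝ) (A : ℝ≥0 → Ω → ℤˣ) : Prop where
  measurable : Measurable (Function.uncurry A)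
  adapted : Adapted 𝓕 A
  exists_solution : ∃ R Θ : ℝ≥0 → Ω → ℝ, IsPositionProcess 𝓕 P B σ v η r θ A R Θ ∧
    ∫⁻ ω, arrivalTime η R ω ∂P < ∞

/-- The cost `J(r, θ, A) = E[τ^A]`. For a given `A`, two position processes agree almost surely up
to the arrival time (for fixed `a` the drift is one-sided Lipschitz in `(r, θ)` away from `r = 0`,
and the noise cancels in the difference), so that the infimum is over one value only. -/
def cost (𝓕 : Filtration ℝ≥0 mΩ) (P : Measure Ω) (B : ℝ≥0 → Ω → ℝ)
    (σ v η r θ : ℝ) (A : ℝ≥0 → Ω → ℤˣ) : ℝ≥0∞ :=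
  ⨅ (R : ℝ≥0 → Ω → ℝ) (Θ : ℝ≥0 → Ω → ℝ) (_ : IsPositionProcess 𝓕 P B σ v η r θ A R Θ),
    ∫⁻ ω, arrivalTime η R ω ∂P

/-- The value function `V(r, θ)`, the infimum of `J(r, θ, A)` over the admissible strategies. -/
def value (𝓕 : Filtration ℝ≥0 mΩ) (P : Measure Ω) (B : ℝ≥0 → Ω → ℝ)
    (σ v η r θ : ℝ) : ℝ≥0∞ :=
  ⨅ (A : ℝ≥0 → Ω → ℤˣ) (_ : IsAdmissible 𝓕 P B σ v η r θ A), cost 𝓕 P B σ v η r θ A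

/-- `A` is an optimal strategy: it is admissible and its cost is the value function. -/
def IsOptimal (𝓕 : Filtration ℝ≥0 mΩ) (P : Measure Ω) (B : ℝ≥0 → Ω → ℝ)
    (σ v η r θ : ℝ) (A : ℝ≥0 → Ω → ℤˣ) : Prop :=
  IsAdmissible 𝓕 P B σ v η r θ A ∧ cost 𝓕 P B σ v η r θ A = value 𝓕 P B σ v η r θ

/-- The function `N(t, r, θ) = t + Ṽ(r, θ)`. -/
def timePlus (V : ℝ → ℝ → ℝ) (t : ℝ≥0) (r θ : ℝ) : ℝ := (t : ℝ) + V r θ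

/-- The process `N(t ∧ τ, R_{t ∧ τ}, Θ_{t ∧ τ})`. -/
def stoppedTimePlus (η : ℝ) (V : ℝ → ℝ → ℝ) (R Θ : ℝ≥0 → Ω → ℝ) (t : ℝ≥0) (ω : Ω) : ℝ :=
  let s : ℝ≥0 := (min (t : ℝ≥0∞) (arrivalTime η R ω)).toNNReal
  timePlus V s (R s ω) (Θ s ω)

end Sailing

end

namespace Sailing

variable {Ω : Type*} {mΩ : MeasurableSpace Ω}

/-! This is a verification argument: compare `V r θ`, the value of N at time 0, with the expectation
of N at time n as n → ∞, where N tends to τ because V vanishes on the target. For the lower bound,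
the speed limit gives R ≤ r + vτ up to time τ, so linear growth of V dominates N by an affine
function of τ. When E τ is finite, dominated convergence turns the submartingale inequality into V ≤
E τ (`ofReal_le_lintegral_arrivalTime`). For the upper bound, V ≥ 0 gives N ≥ n ∧ τ, and monotone
convergence turns the martingale identity into E τ ≤ V (`lintegral_arrivalTime_le_ofReal`). Both
bounds hold for each solution separately, so no uniqueness of solutions is needed. -/

lemma radialDrift_le {v : ℝ} (hv : 0 < v) (θ : ℝ) (a : ℤˣ) : radialDrift v θ a ≤ v := by
  have h1 := Real.neg_one_le_sin (angle θ)
  have h2 := Real.sin_le_one (angle θ)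
  have h3 := Real.neg_one_le_cos (angle θ)
  have h4 := Real.cos_le_one (angle θ)
  unfold radialDrift
  split_ifs <;> nlinarith

/-! ### Hitting times of continuous paths -/

section Arrival

variable {η : ℝ} {R : ℝ≥0 → Ω → ℝ} {ω : Ω}

lemma arrivalTime_le_of_le {t : ℝ≥0} (h : R t ω ≤ η) : arrivalTime η R ω ≤ t :=
  iInf₂_le t h

lemma lt_radius_of_lt_arrivalTime {t : ℝ≥0} (h : (t : ℝ≥0∞) < arrivalTime η R ω) :
    η < R t ω := by
  by_contra! hle
  exact absurd (arrivalTime_le_of_le hle) (not_le.mpr h)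

/-- The arrival time, if finite, is attained. -/
lemma radius_le_of_arrivalTime_eq (hc : Continuous fun t => R t ω) {t : ℝ≥0}
    (h : arrivalTime η R ω = t) : R t ω ≤ η := by
  let S : Set ℝ≥0 := {s | R s ω ≤ η}
  have hS : S.Nonempty := by
    by_contra hne
    have hempty : ∀ s, ¬ R s ω ≤ η := fun s hs => hne ⟨s, hs⟩
    have : arrivalTime η R ω = ∞ := by simp [arrivalTime, hempty]
    exact ENNReal.coe_ne_top (h.symm.trans this)
  have hmem : sInf S ∈ S := (isClosed_le hc continuous_const).csInf_mem hS (OrderBot.bddBelow S)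
  have heq : ((sInf S : ℝ≥0) : ℝ≥0∞) = arrivalTime η R ω := ENNReal.coe_sInf hS
  rw [h, ENNReal.coe_inj] at heq
  exact heq ▸ hmem

/-- The path takes the value η somewhere on [0, t] by the intermediate value theorem, and by
minimality of τ only at t. -/
lemma radius_eq_of_arrivalTime_eq (hc : Continuous fun t => R t ω) (h0 : η ≤ R 0 ω) {t : ℝ≥0}
    (h : arrivalTime η R ω = t) : R t ω = η := by
  obtain ⟨u, hu, hRu⟩ := intermediate_value_Icc' (zero_le : (0 : ℝ≥0) ≤ t) hc.continuousOn
    (⟨radius_le_of_arrivalTime_eq hc h, h0⟩ : η ∈ Set.Icc (R t ω) (R 0 ω))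
  have hut : t ≤ u := by
    have := arrivalTime_le_of_le (η := η) (R := R) (ω := ω) hRu.le
    rw [h] at this
    exact_mod_cast this
  rwa [le_antisymm hut hu.2]

lemma le_radius_of_le_arrivalTime (hc : Continuous fun t => R t ω) (h0 : η ≤ R 0 ω) {t : ℝ≥0}
    (h : (t : ℝ≥0∞) ≤ arrivalTime η R ω) : η ≤ R t ω := by
  rcases h.lt_or_eq with h | h
  · exact (lt_radius_of_lt_arrivalTime h).le
  · exact (radius_eq_of_arrivalTime_eq hc h0 h.symm).ge

lemma lt_arrivalTime_iff (hc : Continuous fun t => R t ω) {t : ℝ≥0} :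
    (t : ℝ≥0∞) < arrivalTime η R ω ↔ ∀ s ≤ t, η < R s ω := by
  refine ⟨fun h s hs => lt_radius_of_lt_arrivalTime (lt_of_le_of_lt (by exact_mod_cast hs) h),
    fun h => ?_⟩
  by_contra! hle
  lift arrivalTime η R ω to ℝ≥0 using ne_top_of_le_ne_top ENNReal.coe_ne_top hle with u hu
  exact absurd (radius_le_of_arrivalTime_eq hc hu.symm) (not_le.mpr (h u (by exact_mod_cast hle)))

/-- The event τ > c says that R exceeds η throughout [0, c]. By compactness it does so by a margin
1/(n+1), and by continuity this margin need only be tested on a countable dense set of times. -/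
lemma measurable_arrivalTime (hR : ∀ t, Measurable (R t))
    (hc : ∀ ω, Continuous fun t => R t ω) : Measurable (arrivalTime η R) := by
  refine measurable_of_Ioi fun c => ?_
  induction c with
  | top => simp [Set.Ioi]
  | coe c =>
    obtain ⟨D, hDc, hD⟩ := TopologicalSpace.exists_countable_dense (Set.Icc (0 : ℝ≥0) c)
    have heq : arrivalTime η R ⁻¹' Set.Ioi (c : ℝ≥0∞) =
        ⋃ n : ℕ, ⋂ q ∈ D, {ω | η + 1 / ((n : ℝ) + 1) ≤ R q ω} := by
      ext ω
      simp only [Set.mem_preimage, Set.mem_Ioi, lt_arrivalTime_iff (hc ω), Set.mem_iUnion,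
        Set.mem_iInter, Set.mem_ofPred_eq]
      constructor
      · intro h
        obtain ⟨x, hx, hmin⟩ := (isCompact_Icc (a := (0 : ℝ≥0)) (b := c)).exists_isMinOn
          ⟨0, by simp⟩ (hc ω).continuousOn
        obtain ⟨n, hn⟩ := exists_nat_one_div_lt (sub_pos.mpr (h x hx.2))
        refine ⟨n, fun q _ => ?_⟩
        have : R x ω ≤ R q ω := hmin q.2
        linarith
      · rintro ⟨n, hn⟩ s hs
        have hclosed : IsClosed {q : Set.Icc (0 : ℝ≥0) c | η + 1 / ((n : ℝ) + 1) ≤ R q ω} :=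
          isClosed_le continuous_const ((hc ω).comp continuous_subtype_val)
        have hmem := hclosed.closure_subset_iff.mpr (fun q hq => hn q hq)
          (hD ⟨s, zero_le, hs⟩)
        have : η + 1 / ((n : ℝ) + 1) ≤ R s ω := hmem
        have : (0 : ℝ) < 1 / ((n : ℝ) + 1) := by positivity
        linarith
    rw [heq]
    exact MeasurableSet.iUnion fun n => MeasurableSet.biInter hDc fun q _ =>
      measurableSet_le measurable_const (hR q)

end Arrival

variable {𝓕 : Filtration ℝ≥0 mΩ} {P : Measure Ω} {B : ℝ≥0 → Ω → ℝ} {σ v η r θ : ℝ}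
  {A : ℝ≥0 → Ω → ℤˣ} {R Θ : ℝ≥0 → Ω → ℝ} {V : ℝ → ℝ → ℝ}

/-! ### Bounds and limits for the stopped process N -/

namespace IsPositionProcess

lemma measurable_arrivalTime (h : IsPositionProcess 𝓕 P B σ v η r θ A R Θ) :
    Measurable (arrivalTime η R) :=
  Sailing.measurable_arrivalTime (fun t => (h.adapted_radius t).mono (𝓕.le t) le_rfl)
    h.continuous_radius

/-- The boat moves at speed at most `v`. -/
lemma radius_le (h : IsPositionProcess 𝓕 P B σ v η r θ A R Θ) (hv : 0 < v) :
    ∀ᵐ ω ∂P, ∀ t : ℝ≥0, (t : ℝ≥0∞) ≤ arrivalTime η R ω → R t ω ≤ r + v * t := by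
  filter_upwards [h.radius_eq] with ω hω
  have hlt : ∀ t : ℝ≥0, (t : ℝ≥0∞) < arrivalTime η R ω → R t ω ≤ r + v * t := by
    intro t ht
    obtain ⟨hint, heq⟩ := hω t ht
    have := intervalIntegral.integral_mono_on t.coe_nonneg hint
      (intervalIntegrable_const (c := v)) fun s _ => radialDrift_le hv _ _
    rw [intervalIntegral.integral_const, smul_eq_mul, sub_zero] at this
    rw [heq]
    linarith
  intro t ht
  -- The integral equation is available only before τ; continuity extends the bound to t = τ. Time 0
  -- is separate because nothing precedes it.
  rcases eq_or_ne t 0 with rfl | ht0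
  · simp [h.initial_radius]
  have hmem : t ∈ closure (Set.Iio t) := by
    rw [closure_Iio' ⟨0, pos_iff_ne_zero.mpr ht0⟩]
    exact Set.mem_Iic.mpr le_rfl
  have hclosed : IsClosed {s : ℝ≥0 | R s ω ≤ r + v * s} :=
    isClosed_le (h.continuous_radius ω) (by fun_prop)
  exact hclosed.closure_subset_iff.mpr
    (fun s hs => hlt s (lt_of_lt_of_le (by exact_mod_cast Set.mem_Iio.mp hs) ht)) hmem

lemma stoppedTimePlus_zero (h : IsPositionProcess 𝓕 P B σ v η r θ A R Θ) (ω : Ω) :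
    stoppedTimePlus η V R Θ 0 ω = V r θ := by
  simp [stoppedTimePlus, timePlus, h.initial_radius, h.initial_angle]

lemma integral_stoppedTimePlus_zero [IsProbabilityMeasure P]
    (h : IsPositionProcess 𝓕 P B σ v η r θ A R Θ) :
    ∫ ω, stoppedTimePlus η V R Θ 0 ω ∂P = V r θ := by
  simp [h.stoppedTimePlus_zero]

lemma min_arrivalTime_le_stoppedTimePlus (h : IsPositionProcess 𝓕 P B σ v η r θ A R Θ)
    (hV : ∀ r θ, η ≤ r → 0 ≤ V r θ) (hr : η ≤ r) (t : ℝ≥0) (ω : Ω) :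
    min (t : ℝ≥0∞) (arrivalTime η R ω) ≤ ENNReal.ofReal (stoppedTimePlus η V R Θ t ω) := by
  have hs : ((min (t : ℝ≥0∞) (arrivalTime η R ω)).toNNReal : ℝ≥0∞) =
      min (t : ℝ≥0∞) (arrivalTime η R ω) :=
    ENNReal.coe_toNNReal (ne_top_of_le_ne_top ENNReal.coe_ne_top (min_le_left _ _))
  have hη := le_radius_of_le_arrivalTime (h.continuous_radius ω)
    (hr.trans_eq (h.initial_radius ω).symm) (hs.trans_le (min_le_right _ _))
  conv_lhs => rw [← hs, ← ENNReal.ofReal_coe_nnreal]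
  exact ENNReal.ofReal_le_ofReal (le_add_of_nonneg_right (hV _ _ hη))

lemma stoppedTimePlus_eq_of_arrivalTime_le (h : IsPositionProcess 𝓕 P B σ v η r θ A R Θ)
    (hV : ∀ θ, V η θ = 0) (hr : η ≤ r) {t : ℝ≥0} {ω : Ω} (ht : arrivalTime η R ω ≤ t) :
    stoppedTimePlus η V R Θ t ω = (arrivalTime η R ω).toReal := by
  have hs : ((arrivalTime η R ω).toNNReal : ℝ≥0∞) = arrivalTime η R ω :=
    ENNReal.coe_toNNReal (ne_top_of_le_ne_top ENNReal.coe_ne_top ht)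
  have hη := radius_eq_of_arrivalTime_eq (h.continuous_radius ω)
    (hr.trans_eq (h.initial_radius ω).symm) hs.symm
  simp only [stoppedTimePlus, timePlus, min_eq_right ht, hη, hV, add_zero]
  rfl

lemma tendsto_integral_stoppedTimePlus (h : IsPositionProcess 𝓕 P B σ v η r θ A R Θ)
    [IsProbabilityMeasure P] (hv : 0 < v) (hr : η ≤ r)
    (hV_nonneg : ∀ r θ, η ≤ r → 0 ≤ V r θ) (hV_zero : ∀ θ, V η θ = 0)
    {C D : ℝ} (hC : 0 ≤ C) (hV_growth : ∀ r θ, η ≤ r → V r θ ≤ C * r + D)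
    (hN : ∀ t, AEStronglyMeasurable (stoppedTimePlus η V R Θ t) P)
    (hτ : ∫⁻ ω, arrivalTime η R ω ∂P ≠ ∞) :
    Tendsto (fun n : ℕ => ∫ ω, stoppedTimePlus η V R Θ n ω ∂P) atTop
      (𝓝 (∫ ω, (arrivalTime η R ω).toReal ∂P)) := by
  have hmeas := h.measurable_arrivalTime
  have hint : Integrable (fun ω => (arrivalTime η R ω).toReal) P :=
    integrable_toReal_of_lintegral_ne_top hmeas.aemeasurable hτ
  refine tendsto_integral_of_dominated_convergence
    (fun ω => (arrivalTime η R ω).toReal + (C * (r + v * (arrivalTime η R ω).toReal) + D))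
    (fun n => hN n) (hint.add ((((integrable_const r).add (hint.const_mul v)).const_mul C).add
      (integrable_const D))) (fun n => ?_) ?_
  · filter_upwards [h.radius_le hv, ae_lt_top hmeas hτ] with ω hle hfin
    have hs : ((min ((n : ℝ≥0) : ℝ≥0∞) (arrivalTime η R ω)).toNNReal : ℝ≥0∞) =
        min ((n : ℝ≥0) : ℝ≥0∞) (arrivalTime η R ω) :=
      ENNReal.coe_toNNReal (ne_top_of_le_ne_top ENNReal.coe_ne_top (min_le_left _ _))
    have hsle : ((min ((n : ℝ≥0) : ℝ≥0∞) (arrivalTime η R ω)).toNNReal : ℝ) ≤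
        (arrivalTime η R ω).toReal :=
      ENNReal.toReal_mono hfin.ne (min_le_right _ _)
    change |_ + _| ≤ _
    generalize (min ((n : ℝ≥0) : ℝ≥0∞) (arrivalTime η R ω)).toNNReal = s at hs hsle ⊢
    have hsτ : (s : ℝ≥0∞) ≤ arrivalTime η R ω := hs.trans_le (min_le_right _ _)
    have hη := le_radius_of_le_arrivalTime (h.continuous_radius ω)
      (hr.trans_eq (h.initial_radius ω).symm) hsτ
    have hR : R s ω ≤ r + v * (arrivalTime η R ω).toReal :=
      (hle s hsτ).trans (by gcongr)
    rw [abs_of_nonneg (add_nonneg s.coe_nonneg (hV_nonneg _ _ hη))]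
    have h1 := hV_growth (R s ω) (Θ s ω) hη
    have h2 := mul_le_mul_of_nonneg_left hR hC
    linarith
  · filter_upwards [ae_lt_top hmeas hτ] with ω hfin
    -- Once n exceeds τ, the sequence is constantly τ.
    obtain ⟨n, hn⟩ := ENNReal.exists_nat_gt hfin.ne
    refine tendsto_const_nhds.congr' ?_
    filter_upwards [eventually_ge_atTop n] with m hm
    refine (h.stoppedTimePlus_eq_of_arrivalTime_le hV_zero hr ?_).symm
    exact hn.le.trans (by exact_mod_cast hm)

lemma ofReal_le_lintegral_arrivalTime (h : IsPositionProcess 𝓕 P B σ v η r θ A R Θ)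
    [IsProbabilityMeasure P] (hv : 0 < v) (hr : η ≤ r)
    (hV_nonneg : ∀ r θ, η ≤ r → 0 ≤ V r θ) (hV_zero : ∀ θ, V η θ = 0)
    {C D : ℝ} (hC : 0 ≤ C) (hV_growth : ∀ r θ, η ≤ r → V r θ ≤ C * r + D)
    (hN : Submartingale (stoppedTimePlus η V R Θ) 𝓕 P) :
    ENNReal.ofReal (V r θ) ≤ ∫⁻ ω, arrivalTime η R ω ∂P := by
  -- The infimum in `cost` also runs over solutions with E τ = ∞, where the bound is trivial.
  by_cases hτ : ∫⁻ ω, arrivalTime η R ω ∂P = ∞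
  · simp [hτ]
  have hmeas := h.measurable_arrivalTime
  have hlim := h.tendsto_integral_stoppedTimePlus hv hr hV_nonneg hV_zero hC hV_growth
    (fun t => (hN.integrable t).aestronglyMeasurable) hτ
  have hle : V r θ ≤ ∫ ω, (arrivalTime η R ω).toReal ∂P := by
    refine ge_of_tendsto' hlim fun n => ?_
    have := hN.setIntegral_le (zero_le : (0 : ℝ≥0) ≤ n) MeasurableSet.univ
    rwa [setIntegral_univ, setIntegral_univ, h.integral_stoppedTimePlus_zero] at this
  rw [integral_toReal hmeas.aemeasurable (ae_lt_top hmeas hτ)] at hle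
  exact ENNReal.ofReal_le_of_le_toReal hle

/-- Monotone convergence of n ∧ τ replaces domination, so neither growth of V nor finiteness of E τ
is assumed. -/
lemma lintegral_arrivalTime_le_ofReal (h : IsPositionProcess 𝓕 P B σ v η r θ A R Θ)
    [IsProbabilityMeasure P] (hr : η ≤ r) (hV_nonneg : ∀ r θ, η ≤ r → 0 ≤ V r θ)
    (hN : Martingale (stoppedTimePlus η V R Θ) 𝓕 P) :
    ∫⁻ ω, arrivalTime η R ω ∂P ≤ ENNReal.ofReal (V r θ) := by
  have hmeas := h.measurable_arrivalTime
  have hlim : Tendsto (fun n : ℕ => ∫⁻ ω, min ((n : ℝ≥0) : ℝ≥0∞) (arrivalTime η R ω) ∂P) atTop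
      (𝓝 (∫⁻ ω, arrivalTime η R ω ∂P)) := by
    refine lintegral_tendsto_of_tendsto_of_monotone
      (fun n => (measurable_const.min hmeas).aemeasurable) (.of_forall fun ω m n hmn => ?_)
      (.of_forall fun ω => ?_)
    · exact min_le_min_right _ (by exact_mod_cast hmn)
    · simpa using ENNReal.tendsto_nat_nhds_top.min (tendsto_const_nhds (x := arrivalTime η R ω))
  refine le_of_tendsto' hlim fun n => ?_
  have heq : ∫ ω, stoppedTimePlus η V R Θ n ω ∂P = V r θ := by
    have := hN.setIntegral_eq (zero_le : (0 : ℝ≥0) ≤ n) MeasurableSet.univ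
    rwa [setIntegral_univ, setIntegral_univ, h.integral_stoppedTimePlus_zero, eq_comm] at this
  have hpos : ∀ ω, 0 ≤ stoppedTimePlus η V R Θ n ω := fun ω =>
    add_nonneg (NNReal.coe_nonneg _) (hV_nonneg _ _ (le_radius_of_le_arrivalTime
      (h.continuous_radius ω) (hr.trans_eq (h.initial_radius ω).symm)
      ((ENNReal.coe_toNNReal_le_self).trans (min_le_right _ _))))
  rw [← heq, ofReal_integral_eq_lintegral_ofReal (hN.integrable n) (.of_forall hpos)]
  exact lintegral_mono fun ω => h.min_arrivalTime_le_stoppedTimePlus hV_nonneg hr n ω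

end IsPositionProcess

end Sailing

theorem mainTheorem3
    {Ω : Type*} {mΩ : MeasurableSpace Ω} (P : Measure Ω) [IsProbabilityMeasure P]
    (𝓕 : Filtration ℝ≥0 mΩ) (B : ℝ≥0 → Ω → ℝ) (hB : Sailing.IsFiltrationBrownian 𝓕 P B)
    (σ v η : ℝ) (hσ : 0 < σ) (hv : 0 < v) (hη : 0 ≤ η)
    (V : ℝ → ℝ → ℝ)
    (hV_nonneg : ∀ r θ, η ≤ r → 0 ≤ V r θ)
    (hV_cont : ContinuousOn (Function.uncurry V) (Set.Ici η ×ˢ Set.univ))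
    (hV_zero : ∀ θ, V η θ = 0)
    (hV_unif : TendstoUniformly V (V η) (𝓝[≥] η))
    (hV_growth : ∃ C D : ℝ, 0 ≤ C ∧ 0 ≤ D ∧ ∀ r θ, η ≤ r → V r θ ≤ C * r + D)
    (r θ : ℝ) (hr : η ≤ r)
    (hsub : ∀ A, Sailing.IsAdmissible 𝓕 P B σ v η r θ A →
      ∀ R Θ, Sailing.IsPositionProcess 𝓕 P B σ v η r θ A R Θ →
        Submartingale (Sailing.stoppedTimePlus η V R Θ) 𝓕 P) :
    ENNReal.ofReal (V r θ) ≤ Sailing.value 𝓕 P B σ v η r θ ∧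
    ∀ A, Sailing.IsAdmissible 𝓕 P B σ v η r θ A →
      ∀ R Θ, Sailing.IsPositionProcess 𝓕 P B σ v η r θ A R Θ →
        Martingale (Sailing.stoppedTimePlus η V R Θ) 𝓕 P →
          ENNReal.ofReal (V r θ) = Sailing.value 𝓕 P B σ v η r θ ∧
          Sailing.IsOptimal 𝓕 P B σ v η r θ A ∧
          ∫⁻ ω, Sailing.arrivalTime η R ω ∂P = Sailing.value 𝓕 P B σ v η r θ := by
  obtain ⟨C, D, hC, -, hgrowth⟩ := hV_growth
  have hvalue : ENNReal.ofReal (V r θ) ≤ Sailing.value 𝓕 P B σ v η r θ :=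
    le_iInf₂ fun A hA => le_iInf fun R => le_iInf₂ fun Θ h =>
      h.ofReal_le_lintegral_arrivalTime hv hr hV_nonneg hV_zero hC hgrowth (hsub A hA R Θ h)
  refine ⟨hvalue, fun A hA R Θ h hN => ?_⟩
  have hle := h.lintegral_arrivalTime_le_ofReal hr hV_nonneg hN
  have hcost : Sailing.cost 𝓕 P B σ v η r θ A ≤ ∫⁻ ω, Sailing.arrivalTime η R ω ∂P :=
    iInf_le_of_le R (iInf₂_le Θ h)
  have hval : Sailing.value 𝓕 P B σ v η r θ ≤ Sailing.cost 𝓕 P B σ v η r θ A := iInf₂_le A hA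
  -- The chain V ≤ value ≤ cost ≤ E τ ≤ V collapses to equalities.
  exact ⟨le_antisymm hvalue (hval.trans (hcost.trans hle)),
    ⟨hA, le_antisymm ((hcost.trans hle).trans hvalue) hval⟩,
    le_antisymm (hle.trans hvalue) (hval.trans hcost)⟩
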